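/- Setting. Customers arrive in a Poisson stream of rate $\lambda>0$ at a system of two servers, each of rate $\mu>0$. Service requirements are i.i.d. with law $G$ on $[0,\infty)$, unit mean and finite second moment. A customer's type $\beta$ (cost per unit delay) has an absolutely continuous law $F$ on $[a,b]$, $0\le a<b<\infty$. The first server serves the highest bidder first (HBF, non-preemptive, no minimum bid, $M=0$). The second is FIFO and charges an admission price $c>0$. Nobody may balk. For $\beta_1\in[a,b]$ and $t\in[0,1]$, the single-threshold policy sends type $\beta$ to FIFO with probability $$p(\beta)=\begin{cases}0&\beta>\beta_1\\ t&\beta=\beta_1\\ 1&\beta<\beta_1.\end{cases}$$ It gives the arrival rates $\lambda_2=\lambda\int p\,dF$ (FIFO) and $\lambda_1=\lambda-\lambda_2$ (HBF). Let $\rho_i=\lambda_i/\mu$, $m_2=\int_0^\infty\tau^2\,dG(\mu\tau)$ and $W_0=\frac{\lambda_1}{2}m_2$, and let $F_1$ be the distribution function of $F$ conditioned on $(\beta_1,b]$; if $F$ gives $(\beta_1,b]$ mass $0$, then $\lambda_1=0$ and $F_1$ plays no role. The expected sojourn times at HBF and FIFO, and the bid at HBF, are $$D_1(\beta)=\frac{\mu^2W_0}{(\mu-\lambda_1(1-F_1(\beta)))^2}+\frac1\mu,\qquad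 D_2=\frac{\lambda_2m_2/2}{1-\rho_2}+\frac1\mu,\qquad X(\beta)=\int_0^\beta\frac{2\rho_1W_0\,y}{(1-\rho_1+\rho_1F_1(y))^3}\,dF_1(y).$$ The policy is a Wardrop equilibrium if both servers are stable ($\lambda_1<\mu$ and $\lambda_2<\mu$) and, for every $\beta\in[a,b]$, $p(\beta)>0$ implies $c+\beta D_2\le X(\beta)+\beta D_1(\beta)$, and $p(\beta)<1$ implies $X(\beta)+\beta D_1(\beta)\le c+\beta D_2$. Lemma. (i) For every $c>0$, no single-threshold policy with $\beta_1\in(a,b]$ and $t\in[0,1]$ is a Wardrop equilibrium. (ii) Consequently, if a single-threshold policy with $\beta_1\in[a,b]$ is a Wardrop equilibrium for some $c>0$, then $\beta_1=a$ and everyone joins HBF: $p(\beta)=0$ for every $\beta\in(a,b]$, hence for $F$-almost every $\beta$, and $\lambda_1=\lambda$. (iii) This case does occur: if $\lambda<\mu$, there is $c_0>0$ such that for every $c\ge c_0$ the policy with $\beta_1=a$ and $t=0$ (so $p=0$ on all of $[a,b]$) is a Wardrop equilibrium, and $X(\beta)+\beta D_1(\beta)<c+\beta D_2$ for every $\beta\in[a,b]$.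 -/

import Mathlib

open Set MeasureTheory

noncomputable section

/-- Data of the two-server system. Customers arrive in a Poisson stream of rate `lam`; both servers
have rate `mu`; `serviceLaw` is the law `G` of the service requirement, nonnegative with unit mean
and finite second moment; `typeLaw` is the law `F` of the customer type (cost per unit delay),
absolutely continuous and carried by `[a, b]`. -/
structure TwoServerSystem where
  lam : ℝ
  mu : ℝ
  a : ℝ
  b : ℝ
  serviceLaw : Measure ℝ
  typeLaw : Measure ℝ
  lam_pos : 0 < lam
  mu_pos : 0 < mu
  a_nonneg : 0 ≤ a
  a_lt_b : a < b
  service_prob : IsProbabilityMeasure serviceLaw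
  service_nonneg : ∀ᵐ s ∂serviceLaw, 0 ≤ s
  service_integrable : Integrable (fun s : ℝ => s) serviceLaw
  service_mean : ∫ s, s ∂serviceLaw = 1
  service_sq_integrable : Integrable (fun s : ℝ => s ^ 2) serviceLaw
  type_prob : IsProbabilityMeasure typeLaw
  type_support : ∀ᵐ x ∂typeLaw, x ∈ Icc a b
  type_ac : typeLaw ≪ volume

namespace TwoServerSystem

variable (Q : TwoServerSystem)

/-- Arrival rate to the FIFO server under the routing `p` (`p β` is the probability that a customer
of type `β` chooses FIFO). -/
def fifoRate (p : ℝ → ℝ) : ℝ := Q.lam * ∫ x, p x ∂Q.typeLaw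

/-- Arrival rate to the HBF server under the routing `p`. -/
def hbfRate (p : ℝ → ℝ) : ℝ := Q.lam - Q.fifoRate p

/-- `∫ τ² dG(mu τ)`, the second moment of a service time: a requirement `s` takes time `s / mu`. -/
def serviceSecondMoment : ℝ :=
  ∫ τ, τ ^ 2 ∂(Q.serviceLaw.map (fun s : ℝ => s / Q.mu))

/-- Mean delay due to the residual service time of the customer in service, in a stable queue with
arrival rate `r`. -/
def residual (r : ℝ) : ℝ := r / 2 * Q.serviceSecondMoment

/-- Expected sojourn time in the FIFO server with arrival rate `r < mu`: the mean waiting time of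
the M/G/1 queue (Pollaczek–Khinchine) plus the mean service time. -/
def fifoDelay (r : ℝ) : ℝ := Q.residual r / (1 - r / Q.mu) + 1 / Q.mu

/-- Single-threshold routing: types below `β₁` use FIFO, types above `β₁` use HBF, and type `β₁`
uses FIFO with probability `t`. -/
def thresholdRouting (β₁ t : ℝ) (β : ℝ) : ℝ :=
  if β₁ < β then 0 else if β = β₁ then t else 1

/-- Type profile (distribution function) `F₁` of the customers at the HBF server under the
single-threshold routing. -/
def hbfProfile (β₁ : ℝ) (β : ℝ) : ℝ :=
  if β < β₁ then 0
  else if β ≤ Q.b then Q.typeLaw.real (Ioc β₁ β) / Q.typeLaw.real (Ioc β₁ Q.b)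
  else 1

/-- The measure `dF₁`: the law of the type conditioned on exceeding the threshold. It is the zero
measure when almost no customer uses HBF. -/
def hbfTypeLaw (β₁ : ℝ) : Measure ℝ := ProbabilityTheory.cond Q.typeLaw (Ioc β₁ Q.b)

/-- `hbfProfile` is the distribution function of `hbfTypeLaw`. -/
theorem hbfTypeLaw_real_Iic (β₁ : ℝ) (h : Q.typeLaw (Ioc β₁ Q.b) ≠ 0) (β : ℝ) :
    (Q.hbfTypeLaw β₁).real (Iic β) = Q.hbfProfile β₁ β := by
  have := Q.type_prob
  have h0 : Q.typeLaw.real (Ioc β₁ Q.b) ≠ 0 := by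
    simpa [Measure.real, ENNReal.toReal_eq_zero_iff] using h
  unfold hbfTypeLaw hbfProfile
  have hc : (ProbabilityTheory.cond Q.typeLaw (Ioc β₁ Q.b)).real (Iic β) =
      (Q.typeLaw.real (Ioc β₁ Q.b))⁻¹ * Q.typeLaw.real (Ioc β₁ Q.b ∩ Iic β) := by
    simp [Measure.real, ProbabilityTheory.cond_apply measurableSet_Ioc]
  rw [hc, Ioc_inter_Iic]
  split_ifs with h1 h2
  · rw [Ioc_eq_empty (fun h' => absurd (lt_of_lt_of_le h' inf_le_right) (not_lt.2 h1.le))]; simp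
  · rw [inf_eq_right.2 h2, inv_mul_eq_div]
  · rw [inf_eq_left.2 (not_le.1 h2).le, inv_mul_cancel₀ h0]

/-- Expected sojourn time `D₁(β) = W₁(β) + 1 / mu` in the HBF server (arrival rate `r < mu`) of a
customer who bids as type `β` does, when the type profile at this server is `hbfProfile β₁`. -/
def hbfDelay (β₁ r : ℝ) (β : ℝ) : ℝ :=
  Q.mu ^ 2 * Q.residual r / (Q.mu - r * (1 - Q.hbfProfile β₁ β)) ^ 2 + 1 / Q.mu

/-- The bid `X(β)` at the HBF server (arrival rate `r < mu`) when the type profile there is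
`hbfProfile β₁`. -/
def hbfBid (β₁ r : ℝ) (β : ℝ) : ℝ :=
  ∫ y in Ioc 0 β,
    2 * (r / Q.mu) * Q.residual r * y / (1 - r / Q.mu + r / Q.mu * Q.hbfProfile β₁ y) ^ 3
    ∂(Q.hbfTypeLaw β₁)

/-- Expected cost of a type-`β` customer at the FIFO server with admission price `c`, when
everybody else follows the single-threshold policy. -/
def fifoCost (c β₁ t β : ℝ) : ℝ :=
  c + β * Q.fifoDelay (Q.fifoRate (thresholdRouting β₁ t))

/-- Expected cost (bid plus delay cost) of a type-`β` customer at the HBF server, with no minimum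
bid, when everybody else follows the single-threshold policy. -/
def hbfCost (β₁ t β : ℝ) : ℝ :=
  Q.hbfBid β₁ (Q.hbfRate (thresholdRouting β₁ t)) β
    + β * Q.hbfDelay β₁ (Q.hbfRate (thresholdRouting β₁ t)) β

/-- The single-threshold policy is a Wardrop equilibrium for the admission price `c`: both servers
are stable (so that the expected delays are finite and given by the formulas above), a type that
uses FIFO with positive probability does not find HBF cheaper, and a type that uses HBF with
positive probability does not find FIFO cheaper. A type that uses both
servers with positive probability is thus indifferent. -/
def IsThresholdEquilibrium (c β₁ t : ℝ) : Prop :=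
  Q.hbfRate (thresholdRouting β₁ t) < Q.mu ∧
  Q.fifoRate (thresholdRouting β₁ t) < Q.mu ∧
  ∀ β ∈ Icc Q.a Q.b,
    (0 < thresholdRouting β₁ t β → Q.fifoCost c β₁ t β ≤ Q.hbfCost β₁ t β) ∧
    (thresholdRouting β₁ t β < 1 → Q.hbfCost β₁ t β ≤ Q.fifoCost c β₁ t β)

end TwoServerSystem

end

namespace TwoServerSystem

open Filter Topology

/-! Below the threshold `β₁` the bid is zero and the HBF delay is a constant `d1`, that of the
lowest priority. Let `d2` be the FIFO delay. If `a < β₁`, type `a` uses FIFO, so `c ≤ a * (d1 -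
d2)`; as `c > 0`, this forces `d1 > d2`. If also `β₁ < b`, the types just above `β₁` use HBF;
dropping their nonnegative bids and letting `β ↓ β₁` gives `β₁ * (d1 - d2) ≤ c`. Together these
contradict `a < β₁`: a low type that would pay `c` to avoid `d1` implies that higher types would
too. If `β₁ = b`, HBF is empty and `d1 = 1 / mu ≤ d2`, again impossible.

For existence, the HBF cost is bounded uniformly over types when everybody uses HBF, so a large `c`
deters all of them from FIFO. -/

instance (Q : TwoServerSystem) : IsProbabilityMeasure Q.typeLaw := Q.type_prob

theorem ae_ne (Q : TwoServerSystem) (x : ℝ) : ∀ᵐ β ∂Q.typeLaw, β ≠ x :=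
  Q.type_ac.ae_le (Measure.ae_ne volume x)

theorem b_pos (Q : TwoServerSystem) : 0 < Q.b := Q.a_nonneg.trans_lt Q.a_lt_b

theorem serviceSecondMoment_nonneg (Q : TwoServerSystem) : 0 ≤ Q.serviceSecondMoment :=
  integral_nonneg fun τ => sq_nonneg τ

theorem residual_nonneg (Q : TwoServerSystem) {r : ℝ} (hr : 0 ≤ r) : 0 ≤ Q.residual r :=
  mul_nonneg (by positivity) Q.serviceSecondMoment_nonneg

theorem thresholdRouting_mem_Icc {β₁ t : ℝ} (ht : t ∈ Icc (0 : ℝ) 1) (β : ℝ) :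
    thresholdRouting β₁ t β ∈ Icc (0 : ℝ) 1 := by
  unfold thresholdRouting
  split_ifs
  · simp
  · exact ht
  · simp

theorem thresholdRouting_of_gt {β₁ t β : ℝ} (h : β₁ < β) : thresholdRouting β₁ t β = 0 := by
  simp [thresholdRouting, h]

theorem thresholdRouting_of_lt {β₁ t β : ℝ} (h : β < β₁) : thresholdRouting β₁ t β = 1 := by
  simp [thresholdRouting, h.not_gt, h.ne]

theorem fifoRate_nonneg (Q : TwoServerSystem) {p : ℝ → ℝ} (hp : ∀ β, 0 ≤ p β) :
    0 ≤ Q.fifoRate p :=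
  mul_nonneg Q.lam_pos.le (integral_nonneg hp)

theorem hbfRate_nonneg (Q : TwoServerSystem) {p : ℝ → ℝ} (hp : ∀ β, p β ∈ Icc (0 : ℝ) 1) :
    0 ≤ Q.hbfRate p := by
  have h : ∫ x, p x ∂Q.typeLaw ≤ ∫ _, (1 : ℝ) ∂Q.typeLaw :=
    integral_mono_of_nonneg (ae_of_all _ fun x => (hp x).1) (integrable_const 1)
      (ae_of_all _ fun x => (hp x).2)
  simp only [integral_const, probReal_univ, smul_eq_mul, mul_one] at h
  unfold hbfRate fifoRate
  nlinarith [Q.lam_pos]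

/-- If the threshold is the largest type, then almost every customer uses FIFO. -/
theorem hbfRate_threshold_b (Q : TwoServerSystem) (t : ℝ) :
    Q.hbfRate (thresholdRouting Q.b t) = 0 := by
  -- Absolute continuity makes the type `b` null, so the value of `t` is irrelevant.
  have h : thresholdRouting Q.b t =ᵐ[Q.typeLaw] fun _ => 1 := by
    filter_upwards [Q.type_support, Q.ae_ne Q.b] with β hβ hne
    exact thresholdRouting_of_lt (lt_of_le_of_ne hβ.2 hne)
  simp [hbfRate, fifoRate, integral_congr_ae h]

/-- If the threshold is the smallest type, then almost every customer uses HBF. -/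
theorem thresholdRouting_a_ae_eq_zero (Q : TwoServerSystem) (t : ℝ) :
    ∀ᵐ β ∂Q.typeLaw, thresholdRouting Q.a t β = 0 := by
  filter_upwards [Q.type_support, Q.ae_ne Q.a] with β hβ hne
  exact thresholdRouting_of_gt (lt_of_le_of_ne hβ.1 hne.symm)

theorem fifoRate_threshold_a (Q : TwoServerSystem) (t : ℝ) :
    Q.fifoRate (thresholdRouting Q.a t) = 0 := by
  have h : thresholdRouting Q.a t =ᵐ[Q.typeLaw] fun _ => 0 := Q.thresholdRouting_a_ae_eq_zero t
  simp [fifoRate, integral_congr_ae h]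

theorem hbfRate_threshold_a (Q : TwoServerSystem) (t : ℝ) :
    Q.hbfRate (thresholdRouting Q.a t) = Q.lam := by
  simp [hbfRate, fifoRate_threshold_a]

theorem inv_mu_le_fifoDelay (Q : TwoServerSystem) {r : ℝ} (h0 : 0 ≤ r) (hr : r < Q.mu) :
    1 / Q.mu ≤ Q.fifoDelay r := by
  have h1 : r / Q.mu < 1 := (div_lt_one Q.mu_pos).2 hr
  exact le_add_of_nonneg_left (div_nonneg (Q.residual_nonneg h0) (sub_nonneg.2 h1.le))

theorem hbfProfile_nonneg (Q : TwoServerSystem) (β₁ β : ℝ) : 0 ≤ Q.hbfProfile β₁ β := by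
  unfold hbfProfile
  split_ifs <;> positivity

theorem hbfProfile_of_lt (Q : TwoServerSystem) {β₁ β : ℝ} (h : β < β₁) :
    Q.hbfProfile β₁ β = 0 := by
  simp [hbfProfile, h]

theorem hbfDelay_of_lt (Q : TwoServerSystem) (r : ℝ) {β₁ β : ℝ} (h : β < β₁) :
    Q.hbfDelay β₁ r β = Q.mu ^ 2 * Q.residual r / (Q.mu - r) ^ 2 + 1 / Q.mu := by
  simp [hbfDelay, Q.hbfProfile_of_lt h]

/-- The bid integrates against a law carried by types above the threshold. -/
theorem hbfBid_of_lt (Q : TwoServerSystem) (r : ℝ) {β₁ β : ℝ} (h : β < β₁) :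
    Q.hbfBid β₁ r β = 0 := by
  have h0 : Q.hbfTypeLaw β₁ (Ioc 0 β) = 0 := by
    rw [hbfTypeLaw, ProbabilityTheory.cond_apply measurableSet_Ioc]
    have : Ioc β₁ Q.b ∩ Ioc 0 β = ∅ := by
      ext x
      simp only [mem_inter_iff, mem_Ioc, mem_empty_iff_false, iff_false]
      rintro ⟨⟨h1, -⟩, -, h2⟩
      linarith
    simp [this]
  rw [hbfBid, Measure.restrict_eq_zero.2 h0, integral_zero_measure]

theorem hbfBid_nonneg (Q : TwoServerSystem) (β₁ : ℝ) {r : ℝ} (h0 : 0 ≤ r) (hr : r < Q.mu)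
    (β : ℝ) : 0 ≤ Q.hbfBid β₁ r β := by
  refine setIntegral_nonneg measurableSet_Ioc fun y hy => ?_
  have h1 : r / Q.mu < 1 := (div_lt_one Q.mu_pos).2 hr
  have h2 := Q.residual_nonneg h0
  have h3 := Q.hbfProfile_nonneg β₁ y
  have h4 : 0 ≤ r / Q.mu := div_nonneg h0 Q.mu_pos.le
  have h5 : 0 ≤ 1 - r / Q.mu := sub_nonneg.2 h1.le
  have h6 := hy.1.le
  positivity

/-- The type profile at HBF is right-continuous at the threshold. -/
theorem tendsto_hbfProfile (Q : TwoServerSystem) {β₁ : ℝ} (hβ₁ : β₁ < Q.b) :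
    Tendsto (Q.hbfProfile β₁) (𝓝[>] β₁) (𝓝 0) := by
  have h1 : Tendsto (fun β => Q.typeLaw.real (Ioc β₁ β)) (𝓝[>] β₁) (𝓝 0) := by
    have h := (ProbabilityTheory.cdf Q.typeLaw).right_continuous β₁
    have h2 : Tendsto (fun β => ProbabilityTheory.cdf Q.typeLaw β
        - ProbabilityTheory.cdf Q.typeLaw β₁) (𝓝[>] β₁) (𝓝 0) := by
      have := (h.mono_left (nhdsWithin_mono _ Ioi_subset_Ici_self)).sub_const
        (ProbabilityTheory.cdf Q.typeLaw β₁)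
      simpa using this
    refine h2.congr' ?_
    filter_upwards [self_mem_nhdsWithin] with β hβ
    rw [ProbabilityTheory.cdf_eq_real, ProbabilityTheory.cdf_eq_real, ← Ioi_inter_Iic, inter_comm,
      ← compl_Iic, ← sdiff_eq, measureReal_sdiff (Iic_subset_Iic.2 (le_of_lt hβ)) measurableSet_Iic]
  have h2 := h1.div_const (Q.typeLaw.real (Ioc β₁ Q.b))
  rw [zero_div] at h2
  refine h2.congr' ?_
  filter_upwards [Ioo_mem_nhdsGT hβ₁] with β hβ
  simp [hbfProfile, hβ.1.not_gt, hβ.2.le]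

/-- The limit is exactly the delay seen below the threshold, which makes the conditions at `a` and
at `β₁` comparable. -/
theorem tendsto_hbfDelay (Q : TwoServerSystem) {β₁ r : ℝ} (hβ₁ : β₁ < Q.b) (hr : r < Q.mu) :
    Tendsto (Q.hbfDelay β₁ r) (𝓝[>] β₁)
      (𝓝 (Q.mu ^ 2 * Q.residual r / (Q.mu - r) ^ 2 + 1 / Q.mu)) := by
  have h := Q.tendsto_hbfProfile hβ₁
  have h1 : Tendsto (fun β => Q.mu - r * (1 - Q.hbfProfile β₁ β)) (𝓝[>] β₁)
      (𝓝 (Q.mu - r)) := by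
    simpa using ((h.const_sub 1).const_mul r).const_sub Q.mu
  exact (tendsto_const_nhds.div (h1.pow 2) (pow_ne_zero 2 (sub_pos.2 hr).ne')).add_const _

/-- No single-threshold policy whose threshold exceeds the smallest type is an equilibrium. -/
theorem not_isThresholdEquilibrium (Q : TwoServerSystem) {c β₁ t : ℝ} (hc : 0 < c)
    (hβ₁ : β₁ ∈ Ioc Q.a Q.b) (ht : t ∈ Icc (0 : ℝ) 1) :
    ¬ Q.IsThresholdEquilibrium c β₁ t := by
  rintro ⟨hs1, hs2, heq⟩
  have hp := thresholdRouting_mem_Icc (β₁ := β₁) ht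
  have hr0 := Q.hbfRate_nonneg hp
  have hD2 := Q.inv_mu_le_fifoDelay (Q.fifoRate_nonneg fun β => (hp β).1) hs2
  have hlow := (heq Q.a ⟨le_rfl, Q.a_lt_b.le⟩).1 (by simp [thresholdRouting_of_lt hβ₁.1])
  unfold fifoCost hbfCost at hlow
  rw [Q.hbfBid_of_lt _ hβ₁.1, Q.hbfDelay_of_lt _ hβ₁.1, zero_add] at hlow
  have ha := Q.a_nonneg
  rcases hβ₁.2.eq_or_lt with hb | hb
  · have h0 : Q.hbfRate (thresholdRouting β₁ t) = 0 := by rw [hb]; exact Q.hbfRate_threshold_b t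
    rw [h0] at hlow
    simp only [residual, zero_div, zero_mul, mul_zero, zero_add] at hlow
    nlinarith
  -- The equilibrium condition is used only strictly above `β₁`, so nothing is assumed about the
  -- choice of type `β₁` itself; nonnegativity of the bid suffices, without its limit.
  · have hhigh : β₁ * (Q.mu ^ 2 * Q.residual (Q.hbfRate (thresholdRouting β₁ t))
          / (Q.mu - Q.hbfRate (thresholdRouting β₁ t)) ^ 2 + 1 / Q.mu)
        ≤ c + β₁ * Q.fifoDelay (Q.fifoRate (thresholdRouting β₁ t)) := by
      have hid : Tendsto (fun β : ℝ => β) (𝓝[>] β₁) (𝓝 β₁) := nhdsWithin_le_nhds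
      refine le_of_tendsto_of_tendsto (hid.mul (Q.tendsto_hbfDelay hb hs1))
        ((hid.mul_const _).const_add c) ?_
      filter_upwards [Ioo_mem_nhdsGT hb] with β hβ
      have h := (heq β ⟨(hβ₁.1.trans hβ.1).le, hβ.2.le⟩).2
        (by simp [thresholdRouting_of_gt hβ.1])
      unfold fifoCost hbfCost at h
      linarith [Q.hbfBid_nonneg β₁ hr0 hs1 β]
    have hgap := hβ₁.1
    set d1 := Q.mu ^ 2 * Q.residual (Q.hbfRate (thresholdRouting β₁ t))
          / (Q.mu - Q.hbfRate (thresholdRouting β₁ t)) ^ 2 + 1 / Q.mu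
    set d2 := Q.fifoDelay (Q.fifoRate (thresholdRouting β₁ t))
    have hpos : 0 < d1 - d2 := by
      by_contra! hle
      nlinarith
    nlinarith

/-- Replace `y` by `b` and the profile in the denominator by `0`; the integrating measure has mass
at most one, even in the degenerate case. -/
theorem hbfBid_le (Q : TwoServerSystem) (β₁ : ℝ) {r β : ℝ} (h0 : 0 ≤ r) (hr : r < Q.mu)
    (hβ : β ≤ Q.b) :
    Q.hbfBid β₁ r β ≤ 2 * (r / Q.mu) * Q.residual r * Q.b / (1 - r / Q.mu) ^ 3 := by
  have h1 : 0 < 1 - r / Q.mu := sub_pos.2 ((div_lt_one Q.mu_pos).2 hr)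
  have h2 := Q.residual_nonneg h0
  have h4 : 0 ≤ r / Q.mu := div_nonneg h0 Q.mu_pos.le
  have hb := Q.b_pos.le
  have : IsZeroOrProbabilityMeasure (Q.hbfTypeLaw β₁) := by
    unfold hbfTypeLaw
    infer_instance
  have hfin : Q.hbfTypeLaw β₁ (Ioc 0 β) < ⊤ := measure_lt_top _ _
  have hle : (Q.hbfTypeLaw β₁).real (Ioc 0 β) ≤ 1 := measureReal_le_one
  have hbound := norm_setIntegral_le_of_norm_le_const hfin
    (f := fun y => 2 * (r / Q.mu) * Q.residual r * y
      / (1 - r / Q.mu + r / Q.mu * Q.hbfProfile β₁ y) ^ 3)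
    (C := 2 * (r / Q.mu) * Q.residual r * Q.b / (1 - r / Q.mu) ^ 3) (by
      intro y hy
      have h3 := Q.hbfProfile_nonneg β₁ y
      have h6 := hy.1.le
      rw [Real.norm_of_nonneg (by positivity)]
      gcongr
      · exact hy.2.trans hβ
      · exact le_add_of_nonneg_right (by positivity))
  calc Q.hbfBid β₁ r β ≤ _ := (le_abs_self _).trans hbound
    _ ≤ _ := mul_le_of_le_one_right (by positivity) hle

theorem hbfDelay_le (Q : TwoServerSystem) (β₁ : ℝ) {r : ℝ} (h0 : 0 ≤ r) (hr : r < Q.mu)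
    (β : ℝ) :
    Q.hbfDelay β₁ r β ≤ Q.mu ^ 2 * Q.residual r / (Q.mu - r) ^ 2 + 1 / Q.mu := by
  have h1 : 0 < Q.mu - r := sub_pos.2 hr
  have h2 := Q.residual_nonneg h0
  have h3 := mul_nonneg h0 (Q.hbfProfile_nonneg β₁ β)
  unfold hbfDelay
  gcongr
  linarith

/-- For a large admission price, every customer strictly prefers HBF when everybody uses HBF. -/
theorem exists_hbfCost_lt_fifoCost (Q : TwoServerSystem) (h : Q.lam < Q.mu) :
    ∃ c₀ : ℝ, 0 < c₀ ∧ ∀ c : ℝ, c₀ ≤ c → ∀ β ∈ Icc Q.a Q.b,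
      Q.hbfCost Q.a 0 β < Q.fifoCost c Q.a 0 β := by
  have hl := Q.lam_pos
  have hmu := Q.mu_pos
  have hb := Q.b_pos
  have h1 : 0 < 1 - Q.lam / Q.mu := sub_pos.2 ((div_lt_one hmu).2 h)
  have h2 := Q.residual_nonneg hl.le
  have h3 : 0 < Q.mu - Q.lam := sub_pos.2 h
  -- Bid bound plus delay-cost bound; the extra `1` makes the inequality strict, since FIFO costs at
  -- least `c`.
  refine ⟨2 * (Q.lam / Q.mu) * Q.residual Q.lam * Q.b / (1 - Q.lam / Q.mu) ^ 3
    + Q.b * (Q.mu ^ 2 * Q.residual Q.lam / (Q.mu - Q.lam) ^ 2 + 1 / Q.mu) + 1,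
    by positivity, fun c hc β hβ => ?_⟩
  have hβ0 : 0 ≤ β := Q.a_nonneg.trans hβ.1
  have hD2 := Q.inv_mu_le_fifoDelay le_rfl hmu
  have hD2' : 0 ≤ β * Q.fifoDelay 0 := mul_nonneg hβ0 (le_trans (by positivity) hD2)
  have hX := Q.hbfBid_le Q.a hl.le h hβ.2
  have hD1 : β * Q.hbfDelay Q.a Q.lam β
      ≤ Q.b * (Q.mu ^ 2 * Q.residual Q.lam / (Q.mu - Q.lam) ^ 2 + 1 / Q.mu) :=
    (mul_le_mul_of_nonneg_left (Q.hbfDelay_le Q.a hl.le h β) hβ0).trans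
      (mul_le_mul_of_nonneg_right hβ.2 (by positivity))
  unfold hbfCost fifoCost
  rw [hbfRate_threshold_a, fifoRate_threshold_a]
  linarith

end TwoServerSystem

theorem lemma1 (Q : TwoServerSystem) :
    (∀ c : ℝ, 0 < c → ¬ ∃ β₁ ∈ Set.Ioc Q.a Q.b, ∃ t ∈ Set.Icc (0 : ℝ) 1,
        Q.IsThresholdEquilibrium c β₁ t) ∧
    (∀ c : ℝ, 0 < c → ∀ β₁ ∈ Set.Icc Q.a Q.b, ∀ t ∈ Set.Icc (0 : ℝ) 1,
        Q.IsThresholdEquilibrium c β₁ t →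
          β₁ = Q.a ∧
          (∀ β ∈ Set.Ioc Q.a Q.b, TwoServerSystem.thresholdRouting β₁ t β = 0) ∧
          (∀ᵐ β ∂Q.typeLaw, TwoServerSystem.thresholdRouting β₁ t β = 0) ∧
          Q.hbfRate (TwoServerSystem.thresholdRouting β₁ t) = Q.lam) ∧
    (Q.lam < Q.mu → ∃ c₀ : ℝ, 0 < c₀ ∧ ∀ c : ℝ, c₀ ≤ c →
        Q.IsThresholdEquilibrium c Q.a 0 ∧
        (∀ β ∈ Set.Icc Q.a Q.b, TwoServerSystem.thresholdRouting Q.a 0 β = 0) ∧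
        (∀ β ∈ Set.Icc Q.a Q.b, Q.hbfCost Q.a 0 β < Q.fifoCost c Q.a 0 β)) := by
  refine ⟨?_, ?_, fun h => ?_⟩
  · rintro c hc ⟨β₁, hβ₁, t, ht, heq⟩
    exact Q.not_isThresholdEquilibrium hc hβ₁ ht heq
  · intro c hc β₁ hβ₁ t ht heq
    obtain rfl : β₁ = Q.a := by
      by_contra hne
      exact Q.not_isThresholdEquilibrium hc ⟨lt_of_le_of_ne hβ₁.1 (Ne.symm hne), hβ₁.2⟩ ht heq
    exact ⟨rfl, fun β hβ => TwoServerSystem.thresholdRouting_of_gt hβ.1,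
      Q.thresholdRouting_a_ae_eq_zero t, Q.hbfRate_threshold_a t⟩
  · obtain ⟨c₀, hc₀, hlt⟩ := Q.exists_hbfCost_lt_fifoCost h
    have hzero : ∀ β ∈ Set.Icc Q.a Q.b, TwoServerSystem.thresholdRouting Q.a 0 β = 0 := by
      intro β hβ
      rcases hβ.1.eq_or_lt with rfl | h'
      · simp [TwoServerSystem.thresholdRouting]
      · exact TwoServerSystem.thresholdRouting_of_gt h'
    refine ⟨c₀, hc₀, fun c hc => ⟨⟨?_, ?_, fun β hβ => ⟨fun hp => ?_, fun _ => ?_⟩⟩, hzero, hlt c hc⟩⟩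
    · rwa [Q.hbfRate_threshold_a]
    · rw [Q.fifoRate_threshold_a]
      exact Q.mu_pos
    · exact absurd (hzero β hβ) hp.ne'
    · exact (hlt c hc β hβ).le
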